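/- Let $\mathbb T=\{z\in\mathbb C:|z|=1\}$, and for an absolutely summable real sequence $c=(c_k)_{k\in\mathbb Z}$ let $c(z)=\sum_{k\in\mathbb Z}c_kz^k$, $z\in\mathbb T$, denote its symbol. Let $s\ge 1$ be an integer and let $\alpha=(\alpha_k)_{k\in\mathbb Z}$ be a finitely supported real sequence that is $s$-banded, that is, $\alpha_k=0$ whenever $|k|>s$. Suppose that $\alpha(z)>0$ (in particular, $\alpha(z)$ is real) for all $z\in\mathbb T$. Set $$\kappa=\frac{\sup_{z\in\mathbb T}|\alpha(z)|}{\inf_{z\in\mathbb T}|\alpha(z)|},\qquad q=\frac{\sqrt\kappa-1}{\sqrt\kappa+1},\qquad \lambda=q^{1/s},\qquad K=\frac{1}{\inf_{z\in\mathbb T}|\alpha(z)|}\max\left\{1,\frac{(1+\sqrt\kappa)^2}{2\kappa}\right\}.$$ Then $\alpha$ has an inverse $\gamma=\alpha^{-1}$, that is, there is exactly one real sequence $\gamma\in l_1(\mathbb Z)$ with $\gamma(z)=1/\alpha(z)$ for all $z\in\mathbb T$, and it satisfies $$|\gamma_\ell|\le K\lambda^{|\ell|}\qquad\text{for all }\ell\in\mathbb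 Z$$ (with $0^0=1$). -/

import Mathlib

open scoped ComplexOrder

noncomputable section

/-- The symbol `c(z) = ∑_{k ∈ ℤ} c_k z^k` of a real bi-infinite sequence. For an absolutely summable
sequence the series converges absolutely at every point of the unit circle. -/
def symbol (c : ℤ → ℝ) (z : ℂ) : ℂ := ∑' k : ℤ, (c k : ℂ) * z ^ k

/-- A sequence is `s`-banded if `c_k = 0` for all `|k| > s`. -/
def IsBanded (s : ℕ) (c : ℤ → ℝ) : Prop := ∀ k : ℤ, (s : ℤ) < |k| → c k = 0

/-- `γ` is the inverse of the mask `α`: it belongs to `l_1(ℤ)` and `γ(z) = 1 / α(z)` for every `z`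
on the unit circle. -/
def IsMaskInverse (α γ : ℤ → ℝ) : Prop :=
  Memℓp (E := fun _ : ℤ => ℝ) γ 1 ∧ ∀ z : Circle, symbol γ (z : ℂ) = 1 / symbol α (z : ℂ)

/-- `sup_{|z| = 1} |α(z)|`. -/
def symbolSup (α : ℤ → ℝ) : ℝ := ⨆ z : Circle, ‖symbol α (z : ℂ)‖

/-- `inf_{|z| = 1} |α(z)|`. -/
def symbolInf (α : ℤ → ℝ) : ℝ := ⨅ z : Circle, ‖symbol α (z : ℂ)‖

/-- `κ = sup |α| / inf |α|`. -/
def kappa (α : ℤ → ℝ) : ℝ := symbolSup α / symbolInf α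

/-- `q = (√κ - 1) / (√κ + 1)`. -/
def decayBase (α : ℤ → ℝ) : ℝ := (√(kappa α) - 1) / (√(kappa α) + 1)

/-- `λ = q^{1/s}`. -/
def decayRate (s : ℕ) (α : ℤ → ℝ) : ℝ := decayBase α ^ (1 / (s : ℝ))

/-- `K = (1 / inf |α|) * max {1, (1 + √κ)² / (2κ)}`. -/
def decayConst (α : ℤ → ℝ) : ℝ :=
  1 / symbolInf α * max 1 ((1 + √(kappa α)) ^ 2 / (2 * kappa α))

end

/-! On the circle `α` takes values in `[a, b]`, with `a` its infimum and `b` its supremum.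
Chebyshev's polynomial `p` of degree at most `n` approximates `1 / x` there within a constant times
`q ^ (n + 1)`, and `p(α)` is a trigonometric polynomial of degree at most `n * s`. Hence for `|l| >
n * s` the `l`-th Fourier coefficient of `1 / α` is that of `1 / α - p(α)`, so at most the sup norm
of this error; the largest admissible `n` gives the decay. Decay makes the coefficients summable, so
they form an inverse; any inverse must consist of these coefficients. -/

/-! ### Chebyshev approximation of the reciprocal -/

open Polynomial in
/-- The value of a Chebyshev polynomial at `(t + t⁻¹) / 2`. -/
theorem Polynomial.Chebyshev.T_eval_half_add_inv {t : ℝ} (ht : 0 < t) (n : ℤ) :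
    (Chebyshev.T ℝ n).eval ((t + t⁻¹) / 2) = (t ^ n + t⁻¹ ^ n) / 2 := by
  have h := Chebyshev.T_real_cosh (Real.log t) n
  rw [Real.cosh_eq, Real.cosh_eq, ← Real.log_inv, Real.exp_log ht, Real.exp_log (inv_pos.2 ht)] at h
  rw [h, Real.exp_neg, mul_comm (n : ℝ), Real.exp_mul, Real.exp_log ht, Real.rpow_intCast, inv_zpow]

open Polynomial in
/-- The numerator of the Chebyshev approximation error of `1 / (c - y)` on `[-1, 1]`,
where `2 c = t + t⁻¹`. -/
noncomputable def chebyshevErrorNumerator (t : ℝ) (n : ℕ) : ℝ[X] :=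
  Chebyshev.T ℝ (n + 1) - C (2 * t) * Chebyshev.T ℝ n + C (t ^ 2) * Chebyshev.T ℝ (n - 1)

open Polynomial in
theorem natDegree_chebyshevErrorNumerator_le (t : ℝ) (n : ℕ) :
    (chebyshevErrorNumerator t n).natDegree ≤ n + 1 := by
  unfold chebyshevErrorNumerator
  -- The index is an integer: for `n = 0` the last term is `T_{-1}`, still of degree `1 = n + 1`.
  have h : ∀ m : ℤ, m.natAbs ≤ n + 1 → (Chebyshev.T ℝ m).natDegree ≤ n + 1 := fun m hm => by
    rwa [Chebyshev.natDegree_T]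
  refine natDegree_add_le_of_degree_le ((natDegree_sub_le _ _).trans (max_le (h _ (by omega)) ?_)) ?_
  · exact (natDegree_C_mul_le _ _).trans (h _ (by omega))
  · exact (natDegree_C_mul_le _ _).trans (h _ (by omega))

-- The powers `t ^ m` cancel in the combination; the powers `t⁻¹ ^ m` leave `(1 - t ^ 2) ^ 2`.
open Polynomial in
theorem chebyshevErrorNumerator_eval_half_add_inv {t : ℝ} (ht : 0 < t) (n : ℕ) :
    (chebyshevErrorNumerator t n).eval ((t + t⁻¹) / 2) = (1 - t ^ 2) ^ 2 / (2 * t ^ (n + 1)) := by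
  simp only [chebyshevErrorNumerator, eval_add, eval_sub, eval_mul, eval_C,
    Chebyshev.T_eval_half_add_inv ht]
  rw [zpow_sub₀ ht.ne', zpow_add₀ ht.ne', zpow_sub₀ (inv_ne_zero ht.ne'),
    zpow_add₀ (inv_ne_zero ht.ne')]
  simp only [zpow_natCast, zpow_one, inv_pow, pow_succ]
  field_simp
  ring

-- At `y = cos θ` the numerator is the real part of `e^{i(n-1)θ} (e^{iθ} - t)²`, and `|e^{iθ} - t|²
-- = 1 + t² - 2ty`.
open Polynomial in
theorem abs_chebyshevErrorNumerator_eval_le (t : ℝ) (n : ℕ) {y : ℝ} (hy : y ∈ Set.Icc (-1 : ℝ) 1) :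
    |(chebyshevErrorNumerator t n).eval y| ≤ 1 + t ^ 2 - 2 * t * y := by
  obtain ⟨θ, rfl⟩ : ∃ θ, y = Real.cos θ := ⟨_, (Real.cos_arccos hy.1 hy.2).symm⟩
  have hP : (chebyshevErrorNumerator t n).eval (Real.cos θ) =
      Real.cos (n * θ) * ((1 + t ^ 2) * Real.cos θ - 2 * t) -
        Real.sin (n * θ) * ((1 - t ^ 2) * Real.sin θ) := by
    simp only [chebyshevErrorNumerator, eval_add, eval_sub, eval_mul, eval_C, Chebyshev.T_real_cos]
    push_cast
    rw [add_mul, sub_mul, one_mul, Real.cos_add, Real.cos_sub]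
    ring
  have hnn : 0 ≤ 1 + t ^ 2 - 2 * t * Real.cos θ := by
    nlinarith [sq_nonneg (t - Real.cos θ), Real.sin_sq_add_cos_sq θ, sq_nonneg (Real.sin θ)]
  rw [hP]
  refine abs_le_of_sq_le_sq ?_ hnn
  set A := (1 + t ^ 2) * Real.cos θ - 2 * t with hA
  set B := (1 - t ^ 2) * Real.sin θ with hB
  have h1 : A ^ 2 + B ^ 2 = (1 + t ^ 2 - 2 * t * Real.cos θ) ^ 2 := by
    have : B ^ 2 = (1 - t ^ 2) ^ 2 * (1 - Real.cos θ ^ 2) := by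
      rw [hB, mul_pow, Real.sin_sq]
    rw [this, hA]
    ring
  rw [← h1]
  have h2 := Real.sin_sq_add_cos_sq (n * θ)
  nlinarith [sq_nonneg (Real.cos (n * θ) * B + Real.sin (n * θ) * A)]

-- With `P` the numerator, take `p = (1 - P / P(c)) / (c - y)`, a polynomial since `1 - P / P(c)`
-- vanishes at `c`. As `|P(y)| ≤ 2t(c - y)`, the factor `c - y` cancels from the error, leaving `2t
-- / P(c)`.
open Polynomial in
theorem exists_polynomial_approx_inv_sub {t : ℝ} (ht : 0 < t) (ht1 : t < 1) (n : ℕ) :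
    ∃ p : ℝ[X], p.natDegree ≤ n ∧ ∀ y ∈ Set.Icc (-1 : ℝ) 1,
      |1 / ((t + t⁻¹) / 2 - y) - p.eval y| ≤ 4 * t ^ (n + 2) / (1 - t ^ 2) ^ 2 := by
  set c := (t + t⁻¹) / 2 with hc
  set P := chebyshevErrorNumerator t n with hP
  have h1t : 0 < 1 - t ^ 2 := by nlinarith
  have hPc : P.eval c = (1 - t ^ 2) ^ 2 / (2 * t ^ (n + 1)) :=
    chebyshevErrorNumerator_eval_half_add_inv ht n
  have hPc0 : 0 < P.eval c := by rw [hPc]; positivity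
  have htc : 2 * t * c = 1 + t ^ 2 := by rw [hc]; field_simp; ring
  refine ⟨C (P.eval c)⁻¹ * (P /ₘ (X - C c)), ?_, fun y hy => ?_⟩
  · refine (natDegree_C_mul_le _ _).trans ?_
    rw [natDegree_divByMonic _ (monic_X_sub_C c), natDegree_X_sub_C]
    exact Nat.sub_le_of_le_add (natDegree_chebyshevErrorNumerator_le t n)
  · have hcy : 0 < c - y := by
      have : 0 < 2 * t * (c - y) := by nlinarith [hy.2, sq_nonneg (1 - t), mul_le_mul_of_nonneg_left hy.2 ht.le]
      exact pos_of_mul_pos_right this (by positivity)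
    have hdiv : P.eval y = P.eval c + (y - c) * (P /ₘ (X - C c)).eval y := by
      have := congrArg (eval y) (modByMonic_add_div P (X - C c))
      rw [modByMonic_X_sub_C_eq_C_eval] at this
      simpa using this.symm
    have herr : 1 / (c - y) - (C (P.eval c)⁻¹ * (P /ₘ (X - C c))).eval y =
        P.eval y / (P.eval c * (c - y)) := by
      rw [hdiv, eval_mul, eval_C]
      field_simp
      ring
    have hle := abs_chebyshevErrorNumerator_eval_le t n hy
    rw [herr, abs_div, abs_of_pos (mul_pos hPc0 hcy), div_le_iff₀ (mul_pos hPc0 hcy)]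
    refine hle.trans (le_of_eq ?_)
    rw [hPc, ← htc, pow_succ t (n + 1)]
    field_simp
    ring

open Polynomial in
/-- Chebyshev's approximation of `1 / x` on `[a, b]`. -/
theorem exists_polynomial_approx_inv {a b : ℝ} (ha : 0 < a) (hab : a ≤ b) (n : ℕ) :
    ∃ p : ℝ[X], p.natDegree ≤ n ∧ ∀ x ∈ Set.Icc a b, |1 / x - p.eval x| ≤
      1 / a * ((1 + √(b / a)) ^ 2 / (2 * (b / a))) *
        ((√(b / a) - 1) / (√(b / a) + 1)) ^ (n + 1) := by
  -- If `a = b` then `t` would be `0`; a constant polynomial is exact.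
  rcases hab.eq_or_lt with rfl | hlt
  · refine ⟨C (1 / a), by simp, fun x hx => ?_⟩
    obtain rfl : x = a := le_antisymm hx.2 hx.1
    simp [ha.ne']
  set k := √(b / a) with hk
  have hk2 : b / a = k ^ 2 := (Real.sq_sqrt (div_nonneg (ha.le.trans hab) ha.le)).symm
  have hb : b = k ^ 2 * a := by rw [← hk2]; field_simp
  have hk1 : 1 < k := by rw [hk, Real.lt_sqrt zero_le_one, one_pow, one_lt_div ha]; exact hlt
  rw [hk2]
  clear_value k
  subst hb
  have hk0 : 0 < k - 1 := by linarith
  have hkp : 0 < k := by linarith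
  have hk0' : 0 < k ^ 2 - 1 := by nlinarith
  -- The decreasing affine map from `[a, b]` onto `[-1, 1]` sends `0` to `c = (k² + 1) / (k² - 1)`,
  -- and this `t` solves `t + t⁻¹ = 2c`.
  obtain ⟨p, hp, hpx⟩ := exists_polynomial_approx_inv_sub (t := (k - 1) / (k + 1))
    (div_pos hk0 (by positivity)) (by rw [div_lt_one (by positivity)]; linarith) n
  have hc : ((k - 1) / (k + 1) + ((k - 1) / (k + 1))⁻¹) / 2 = (k ^ 2 + 1) / (k ^ 2 - 1) := by
    have : k ^ 2 - 1 = (k - 1) * (k + 1) := by ring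
    rw [this]
    field_simp
    ring
  set w := (k ^ 2 - 1) * a with hw
  have hw0 : 0 < w := by positivity
  refine ⟨C (2 / w) * p.comp (C ((k ^ 2 + 1) / (k ^ 2 - 1)) - C (2 / w) * X), ?_, fun x hx => ?_⟩
  · refine (natDegree_C_mul_le _ _).trans (natDegree_comp_le.trans ?_)
    have : (C ((k ^ 2 + 1) / (k ^ 2 - 1)) - C (2 / w) * X : ℝ[X]).natDegree ≤ 1 := by compute_degree
    nlinarith
  · have hx0 : 0 < x := ha.trans_le hx.1
    have hy : (k ^ 2 + 1) / (k ^ 2 - 1) - 2 / w * x ∈ Set.Icc (-1 : ℝ) 1 := by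
      have : (k ^ 2 + 1) / (k ^ 2 - 1) - 2 / w * x = ((k ^ 2 + 1) * a - 2 * x) / w := by
        rw [hw]; field_simp
      rw [this]
      constructor
      · rw [le_div_iff₀ hw0, hw]; linarith [hx.2]
      · rw [div_le_iff₀ hw0, hw]; linarith [hx.1]
    have h := mul_le_mul_of_nonneg_left (hpx _ hy) (by positivity : 0 ≤ 2 / w)
    rw [hc, ← abs_of_pos (by positivity : 0 < 2 / w), ← abs_mul,
      abs_of_pos (by positivity : 0 < 2 / w)] at h
    refine (le_of_eq ?_).trans (h.trans (le_of_eq ?_))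
    · congr 1
      simp only [eval_mul, eval_C, eval_comp, eval_sub, eval_X]
      rw [mul_sub]
      congr 1
      field_simp
      ring
    · have h1 : 1 - ((k - 1) / (k + 1)) ^ 2 = 4 * k / (k + 1) ^ 2 := by
        field_simp
        ring
      have h2 : w = (k - 1) * (k + 1) * a := by rw [hw]; ring
      rw [h1, h2, pow_succ ((k - 1) / (k + 1)) (n + 1)]
      generalize ((k - 1) / (k + 1)) ^ (n + 1) = Q
      field_simp
      ring

/-! ### Fourier coefficients and symbols -/

/-- The `l`-th Fourier coefficient as a continuous linear functional on continuous functions. -/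
noncomputable def fourierCoeffCLM (l : ℤ) : C(UnitAddCircle, ℂ) →L[ℂ] ℂ :=
  LinearMap.mkContinuous
    { toFun := fun f => fourierCoeff f l
      map_add' := fun f g => by
        have h (f : C(UnitAddCircle, ℂ)) : MeasureTheory.Integrable f AddCircle.haarAddCircle :=
          f.continuous.integrable_of_hasCompactSupport (HasCompactSupport.of_compactSpace _)
        rw [ContinuousMap.coe_add, fourierCoeff.add (h f) (h g), Pi.add_apply]
      map_smul' := fun c f => fourierCoeff.const_smul f c l }
    1 fun f => by
      rw [one_mul]
      refine (MeasureTheory.norm_integral_le_of_norm_le_const (C := ‖f‖)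
        (Filter.Eventually.of_forall fun t => ?_)).trans (by simp)
      rw [norm_smul, fourier_apply, Circle.norm_coe, one_mul]
      exact f.norm_coe_le_norm t

theorem fourierCoeffCLM_apply (l : ℤ) (f : C(UnitAddCircle, ℂ)) :
    fourierCoeffCLM l f = fourierCoeff f l := rfl

theorem norm_fourierCoeffCLM_apply_le (l : ℤ) (f : C(UnitAddCircle, ℂ)) :
    ‖fourierCoeffCLM l f‖ ≤ ‖f‖ := by
  have h := (fourierCoeffCLM l).le_of_opNorm_le
    (LinearMap.mkContinuous_norm_le _ zero_le_one _) f
  rwa [one_mul] at h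

theorem fourierCoeffCLM_fourier (l k : ℤ) :
    fourierCoeffCLM l (fourier k) = if l = k then 1 else 0 := by
  rw [fourierCoeffCLM_apply, fourierCoeff_fourier, Pi.single_apply]

/-- The symbol of a sequence, as a continuous function on `ℝ / ℤ`. -/
noncomputable def symbolMap (c : ℤ → ℝ) : C(UnitAddCircle, ℂ) := ∑' k : ℤ, (c k : ℂ) • fourier k

theorem summable_smul_fourier {c : ℤ → ℝ} (hc : Summable fun k => |c k|) :
    Summable fun k : ℤ => (c k : ℂ) • (fourier k : C(UnitAddCircle, ℂ)) :=
  Summable.of_norm (by simpa [norm_smul, fourier_norm] using hc)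

theorem symbolMap_apply {c : ℤ → ℝ} (hc : Summable fun k => |c k|) (x : UnitAddCircle) :
    symbolMap c x = symbol c (AddCircle.toCircle x : ℂ) := by
  have h := ContinuousMap.hasSum_apply (summable_smul_fourier hc).hasSum x
  rw [symbolMap, symbol, ← h.tsum_eq]
  congr 1 with k
  simp [AddCircle.toCircle_zsmul]

theorem fourierCoeffCLM_symbolMap {c : ℤ → ℝ} (hc : Summable fun k => |c k|) (l : ℤ) :
    fourierCoeffCLM l (symbolMap c) = c l := by
  rw [symbolMap, (fourierCoeffCLM l).map_tsum (summable_smul_fourier hc), tsum_eq_single l]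
  · simp [fourierCoeffCLM_fourier]
  · intro k hk
    simp [fourierCoeffCLM_fourier, hk.symm]

/-! ### Real trigonometric polynomials -/

/-- Trigonometric polynomials of degree at most `m` with real coefficients. -/
noncomputable def realTrig (m : ℕ) : Submodule ℝ C(UnitAddCircle, ℂ) :=
  Submodule.span ℝ (fourier '' {k : ℤ | k.natAbs ≤ m})

theorem realTrig_mono {m n : ℕ} (h : m ≤ n) : realTrig m ≤ realTrig n :=
  Submodule.span_mono (Set.image_mono fun _ hk => le_trans hk h)

theorem mul_mem_realTrig {m n : ℕ} {f g : C(UnitAddCircle, ℂ)} (hf : f ∈ realTrig m)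
    (hg : g ∈ realTrig n) : f * g ∈ realTrig (m + n) := by
  have h := Submodule.mul_mem_mul hf hg
  rw [realTrig, realTrig, Submodule.span_mul_span] at h
  refine Submodule.span_mono ?_ h
  rintro _ ⟨_, ⟨j, hj, rfl⟩, _, ⟨k, hk, rfl⟩, rfl⟩
  refine ⟨j + k, ?_, ?_⟩
  · simp only [Set.mem_ofPred_eq] at hj hk ⊢
    omega
  · ext x
    exact fourier_add

theorem one_mem_realTrig (m : ℕ) : 1 ∈ realTrig m := by
  refine Submodule.subset_span ⟨0, by simp, ?_⟩
  ext x
  exact fourier_zero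

theorem pow_mem_realTrig {m : ℕ} {f : C(UnitAddCircle, ℂ)} (hf : f ∈ realTrig m) (j : ℕ) :
    f ^ j ∈ realTrig (j * m) := by
  induction j with
  | zero => simpa using one_mem_realTrig _
  | succ j ih =>
    rw [pow_succ, add_mul, one_mul]
    exact mul_mem_realTrig ih hf

open Polynomial in
theorem aeval_mem_realTrig {m n : ℕ} {f : C(UnitAddCircle, ℂ)} (hf : f ∈ realTrig m) {p : ℝ[X]}
    (hp : p.natDegree ≤ n) : aeval f p ∈ realTrig (n * m) := by
  rw [aeval_eq_sum_range]
  refine Submodule.sum_mem _ fun j hj => Submodule.smul_mem _ _ ?_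
  refine realTrig_mono (Nat.mul_le_mul_right m ?_) (pow_mem_realTrig hf j)
  rw [Finset.mem_range] at hj
  omega

theorem fourierCoeffCLM_im_of_mem_realTrig {m : ℕ} {f : C(UnitAddCircle, ℂ)} (hf : f ∈ realTrig m)
    (l : ℤ) : (fourierCoeffCLM l f).im = 0 := by
  induction hf using Submodule.span_induction with
  | mem f hf =>
    obtain ⟨k, -, rfl⟩ := hf
    rw [fourierCoeffCLM_fourier]
    split_ifs <;> simp
  | zero => simp
  | add f g _ _ hf hg => simp [hf, hg]
  | smul r f _ hf =>
    have : r • f = (r : ℂ) • f := by ext x; simp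
    rw [this, map_smul]
    simp [hf]

theorem fourierCoeffCLM_eq_zero_of_mem_realTrig {m : ℕ} {f : C(UnitAddCircle, ℂ)}
    (hf : f ∈ realTrig m) {l : ℤ} (hl : m < l.natAbs) : fourierCoeffCLM l f = 0 := by
  induction hf using Submodule.span_induction with
  | mem f hf =>
    obtain ⟨k, hk, rfl⟩ := hf
    simp only [Set.mem_ofPred_eq] at hk
    rw [fourierCoeffCLM_fourier, if_neg (by rintro rfl; omega)]
  | zero => simp
  | add f g _ _ hf hg => simp [hf, hg]
  | smul r f _ hf =>
    have : r • f = (r : ℂ) • f := by ext x; simp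
    rw [this, map_smul, hf, smul_zero]

theorem summable_abs_of_finite_support {c : ℤ → ℝ} (hc : (Function.support c).Finite) :
    Summable fun k => |c k| :=
  summable_of_hasFiniteSupport (hc.subset fun k hk => by simpa using hk)

theorem symbolMap_mem_realTrig {c : ℤ → ℝ} (hc : (Function.support c).Finite) {s : ℕ}
    (hband : IsBanded s c) : symbolMap c ∈ realTrig s := by
  rw [symbolMap, tsum_eq_sum (s := hc.toFinset) fun k hk => by
    rw [Set.Finite.mem_toFinset, Function.mem_support, not_not] at hk
    ext x
    simp [hk]]
  refine Submodule.sum_mem _ fun k hk => ?_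
  have : (c k : ℂ) • (fourier k : C(UnitAddCircle, ℂ)) = c k • fourier k := by ext x; simp
  rw [this]
  refine Submodule.smul_mem _ _ (Submodule.subset_span ⟨k, ?_, rfl⟩)
  rw [Set.Finite.mem_toFinset, Function.mem_support] at hk
  by_contra h
  simp only [Set.mem_ofPred_eq, not_le] at h
  exact hk (hband k (by rw [Int.abs_eq_natAbs]; omega))

/-! ### Range of the symbol on the circle -/

theorem exists_toCircle_eq (z : Circle) : ∃ x : UnitAddCircle, AddCircle.toCircle x = z :=
  ⟨(AddCircle.homeomorphCircle one_ne_zero).symm z, by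
    rw [← AddCircle.homeomorphCircle_apply one_ne_zero, Homeomorph.apply_symm_apply]⟩

theorem continuous_symbol_circle {c : ℤ → ℝ} (hc : Summable fun k => |c k|) :
    Continuous fun z : Circle => symbol c (z : ℂ) := by
  have h : (fun z : Circle => symbol c (z : ℂ)) =
      symbolMap c ∘ (AddCircle.homeomorphCircle one_ne_zero).symm := by
    ext z
    rw [Function.comp_apply, symbolMap_apply hc, ← AddCircle.homeomorphCircle_apply one_ne_zero,
      Homeomorph.apply_symm_apply]
  rw [h]
  exact (symbolMap c).continuous.comp (Homeomorph.continuous _)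

theorem norm_symbol_mem_Icc {c : ℤ → ℝ} (hc : Summable fun k => |c k|) (z : Circle) :
    ‖symbol c (z : ℂ)‖ ∈ Set.Icc (symbolInf c) (symbolSup c) := by
  have h := isCompact_range (continuous_symbol_circle hc).norm
  exact ⟨ciInf_le h.bddBelow z, le_ciSup h.bddAbove z⟩

theorem symbolInf_pos {c : ℤ → ℝ} (hc : Summable fun k => |c k|)
    (hpos : ∀ z : Circle, 0 < symbol c (z : ℂ)) : 0 < symbolInf c := by
  have h := isCompact_range (continuous_symbol_circle hc).norm
  obtain ⟨z, hz⟩ := h.sInf_mem (Set.range_nonempty _)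
  rw [symbolInf, iInf, ← hz]
  exact norm_pos_iff.2 (hpos z).ne'

theorem one_le_kappa {c : ℤ → ℝ} (hc : Summable fun k => |c k|)
    (hpos : ∀ z : Circle, 0 < symbol c (z : ℂ)) : 1 ≤ kappa c := by
  rw [kappa, one_le_div (symbolInf_pos hc hpos)]
  exact (norm_symbol_mem_Icc hc 1).1.trans (norm_symbol_mem_Icc hc 1).2

theorem decayBase_nonneg {c : ℤ → ℝ} (h : 1 ≤ kappa c) : 0 ≤ decayBase c := by
  have : 1 ≤ √(kappa c) := Real.one_le_sqrt.2 h
  exact div_nonneg (by linarith) (by linarith)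

theorem decayBase_lt_one (c : ℤ → ℝ) : decayBase c < 1 := by
  have := Real.sqrt_nonneg (kappa c)
  rw [decayBase, div_lt_one (by linarith)]
  linarith

/-! ### Fourier coefficients of the reciprocal -/

/-- The reciprocal of a symbol without zeros, as a continuous function on `ℝ / ℤ`. -/
noncomputable def symbolInvMap (c : ℤ → ℝ) (h0 : ∀ x, symbolMap c x ≠ 0) : C(UnitAddCircle, ℂ) where
  toFun x := (symbolMap c x)⁻¹
  continuous_toFun := (symbolMap c).continuous.inv₀ h0

theorem symbolInvMap_apply (c : ℤ → ℝ) (h0 : ∀ x, symbolMap c x ≠ 0) (x : UnitAddCircle) :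
    symbolInvMap c h0 x = (symbolMap c x)⁻¹ := rfl

theorem symbolMap_eq_ofReal {c : ℤ → ℝ} (hc : Summable fun k => |c k|)
    (hpos : ∀ z : Circle, 0 < symbol c (z : ℂ)) (x : UnitAddCircle) :
    ∃ r ∈ Set.Icc (symbolInf c) (symbolSup c), symbolMap c x = (r : ℂ) := by
  refine ⟨_, norm_symbol_mem_Icc hc (AddCircle.toCircle x), ?_⟩
  rw [symbolMap_apply hc]
  exact Complex.eq_coe_norm_of_nonneg (hpos _).le

open Polynomial in
/-- The reciprocal symbol is approximated by real trigonometric polynomials at the Chebyshev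
rate. -/
theorem exists_realTrig_approx_symbolInvMap {s : ℕ} {α : ℤ → ℝ}
    (hfin : (Function.support α).Finite) (hband : IsBanded s α)
    (hpos : ∀ z : Circle, 0 < symbol α (z : ℂ)) (h0 : ∀ x, symbolMap α x ≠ 0) (n : ℕ) :
    ∃ f ∈ realTrig (n * s), ‖symbolInvMap α h0 - f‖ ≤
      decayConst α * decayBase α ^ (n + 1) := by
  have hs := summable_abs_of_finite_support hfin
  have ha := symbolInf_pos hs hpos
  have hq := decayBase_nonneg (one_le_kappa hs hpos)
  obtain ⟨p, hp, hpx⟩ := exists_polynomial_approx_inv ha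
    ((norm_symbol_mem_Icc hs 1).1.trans (norm_symbol_mem_Icc hs 1).2) n
  have hK : 0 ≤ decayConst α :=
    mul_nonneg (one_div_nonneg.2 ha.le) (zero_le_one.trans (le_max_left _ _))
  refine ⟨aeval (symbolMap α) p, aeval_mem_realTrig (symbolMap_mem_realTrig hfin hband) hp,
    (ContinuousMap.norm_le _ (mul_nonneg hK (pow_nonneg hq _))).2 fun x => ?_⟩
  obtain ⟨r, hr, hx⟩ := symbolMap_eq_ofReal hs hpos x
  have heval : aeval (symbolMap α) p x = ((p.eval r : ℝ) : ℂ) := by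
    rw [aeval_eq_sum_range, eval_eq_sum_range, ContinuousMap.sum_apply, Complex.ofReal_sum]
    exact Finset.sum_congr rfl fun j _ => by simp [hx]
  rw [ContinuousMap.sub_apply, heval, symbolInvMap_apply, hx, ← Complex.ofReal_inv,
    ← Complex.ofReal_sub, Complex.norm_real, Real.norm_eq_abs, inv_eq_one_div]
  refine (hpx r hr).trans (mul_le_mul_of_nonneg_right ?_ (pow_nonneg hq _))
  exact mul_le_mul_of_nonneg_left (le_max_right _ _) (one_div_nonneg.2 ha.le)

/-- The approximants have real coefficients, and coefficients depend continuously on the function.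
-/
theorem fourierCoeffCLM_symbolInvMap_im {s : ℕ} {α : ℤ → ℝ}
    (hfin : (Function.support α).Finite) (hband : IsBanded s α)
    (hpos : ∀ z : Circle, 0 < symbol α (z : ℂ)) (h0 : ∀ x, symbolMap α x ≠ 0) (l : ℤ) :
    (fourierCoeffCLM l (symbolInvMap α h0)).im = 0 := by
  have hq := decayBase_nonneg (one_le_kappa (summable_abs_of_finite_support hfin) hpos)
  have hlim : Filter.Tendsto (fun n : ℕ => decayConst α * decayBase α ^ (n + 1)) Filter.atTop
      (nhds 0) := by
    simpa using ((Filter.tendsto_add_atTop_iff_nat 1).2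
      (tendsto_pow_atTop_nhds_zero_of_lt_one hq (decayBase_lt_one α))).const_mul (decayConst α)
  rw [← abs_nonpos_iff]
  refine ge_of_tendsto' hlim fun n => ?_
  obtain ⟨f, hf, hle⟩ := exists_realTrig_approx_symbolInvMap hfin hband hpos h0 n
  have h := Complex.abs_im_le_norm (fourierCoeffCLM l (symbolInvMap α h0 - f))
  rw [map_sub, Complex.sub_im, fourierCoeffCLM_im_of_mem_realTrig hf, sub_zero, ← map_sub] at h
  exact h.trans ((norm_fourierCoeffCLM_apply_le l _).trans hle)

theorem norm_fourierCoeffCLM_symbolInvMap_le {s : ℕ} (hs : 1 ≤ s) {α : ℤ → ℝ}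
    (hfin : (Function.support α).Finite) (hband : IsBanded s α)
    (hpos : ∀ z : Circle, 0 < symbol α (z : ℂ)) (h0 : ∀ x, symbolMap α x ≠ 0) (l : ℤ) :
    ‖fourierCoeffCLM l (symbolInvMap α h0)‖ ≤ decayConst α * decayRate s α ^ l.natAbs := by
  have hsum := summable_abs_of_finite_support hfin
  have ha := symbolInf_pos hsum hpos
  have hq := decayBase_nonneg (one_le_kappa hsum hpos)
  have hK : 1 / symbolInf α ≤ decayConst α :=
    le_mul_of_one_le_right (one_div_nonneg.2 ha.le) (le_max_left _ _)
  rcases Nat.eq_zero_or_pos l.natAbs with hl | hl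
  -- No `n` satisfies `n * s < 0`, so only the sup norm of `1 / α` is available; hence the `1` in
  -- the maximum defining `K`.
  · rw [hl, pow_zero, mul_one]
    refine (norm_fourierCoeffCLM_apply_le l _).trans (le_trans ?_ hK)
    refine (ContinuousMap.norm_le _ (one_div_nonneg.2 ha.le)).2 fun x => ?_
    rw [symbolInvMap_apply, symbolMap_apply hsum, norm_inv, inv_eq_one_div]
    exact one_div_le_one_div_of_le ha (norm_symbol_mem_Icc hsum _).1
  -- The largest `n` with `n * s < |l|`; it satisfies `|l| ≤ s * (n + 1)`.
  · obtain ⟨f, hf, hle⟩ :=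
      exists_realTrig_approx_symbolInvMap hfin hband hpos h0 ((l.natAbs - 1) / s)
    have hlow : (l.natAbs - 1) / s * s < l.natAbs :=
      (Nat.div_mul_le_self _ _).trans_lt (by omega)
    have hupp : l.natAbs ≤ s * ((l.natAbs - 1) / s + 1) := by
      have := Nat.lt_mul_div_succ (l.natAbs - 1) hs
      omega
    have h := (norm_fourierCoeffCLM_apply_le l (symbolInvMap α h0 - f)).trans hle
    rw [map_sub, fourierCoeffCLM_eq_zero_of_mem_realTrig hf hlow, sub_zero] at h
    refine h.trans (mul_le_mul_of_nonneg_left ?_ ((one_div_nonneg.2 ha.le).trans hK))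
    have hrate : decayRate s α ^ s = decayBase α := by
      rw [decayRate, one_div, Real.rpow_inv_natCast_pow hq (by omega)]
    rw [← hrate, ← pow_mul]
    exact pow_le_pow_of_le_one (Real.rpow_nonneg hq _)
      (Real.rpow_le_one hq (decayBase_lt_one α).le (by positivity)) hupp

/-! ### Existence, uniqueness and decay of the inverse -/

theorem summable_pow_natAbs {r : ℝ} (h0 : 0 ≤ r) (h1 : r < 1) :
    Summable fun l : ℤ => r ^ l.natAbs :=
  .of_nat_of_neg (by simpa using summable_geometric_of_lt_one h0 h1)
    (by simpa using summable_geometric_of_lt_one h0 h1)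

theorem isMaskInverse_iff_summable {α γ : ℤ → ℝ} : IsMaskInverse α γ ↔
    (Summable fun k => |γ k|) ∧ ∀ z : Circle, symbol γ (z : ℂ) = 1 / symbol α (z : ℂ) := by
  rw [IsMaskInverse, memℓp_gen_iff (by simp)]
  simp

theorem mainTheorem10 (s : ℕ) (hs : 1 ≤ s) (α : ℤ → ℝ) (hfin : (Function.support α).Finite)
    (hband : IsBanded s α) (hpos : ∀ z : Circle, 0 < symbol α (z : ℂ)) :
    (∃! γ : ℤ → ℝ, IsMaskInverse α γ) ∧
      ∀ γ : ℤ → ℝ, IsMaskInverse α γ →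
        ∀ l : ℤ, |γ l| ≤ decayConst α * decayRate s α ^ l.natAbs := by
  have hsum := summable_abs_of_finite_support hfin
  have hq := decayBase_nonneg (one_le_kappa hsum hpos)
  have h0 : ∀ x, symbolMap α x ≠ 0 := fun x => by
    rw [symbolMap_apply hsum]
    exact (hpos _).ne'
  have hcoeff : ∀ γ, IsMaskInverse α γ →
      ∀ l, (γ l : ℂ) = fourierCoeffCLM l (symbolInvMap α h0) := fun γ hγ l => by
    rw [isMaskInverse_iff_summable] at hγ
    rw [← fourierCoeffCLM_symbolMap hγ.1]
    congr 1
    ext x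
    rw [symbolMap_apply hγ.1, hγ.2, symbolInvMap_apply, symbolMap_apply hsum, one_div]
  have hbound := norm_fourierCoeffCLM_symbolInvMap_le hs hfin hband hpos h0
  have hrate : decayRate s α < 1 := Real.rpow_lt_one hq (decayBase_lt_one α) (by positivity)
  have hsummable : Summable fun l => ‖fourierCoeffCLM l (symbolInvMap α h0)‖ :=
    .of_nonneg_of_le (fun _ => norm_nonneg _) hbound
      ((summable_pow_natAbs (Real.rpow_nonneg hq _) hrate).mul_left _)
  have hre : ∀ l, ((fourierCoeffCLM l (symbolInvMap α h0)).re : ℂ) =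
      fourierCoeffCLM l (symbolInvMap α h0) := fun l =>
    Complex.ext rfl (fourierCoeffCLM_symbolInvMap_im hfin hband hpos h0 l).symm
  refine ⟨⟨fun l => (fourierCoeffCLM l (symbolInvMap α h0)).re, ?_, fun γ hγ => ?_⟩,
    fun γ hγ l => ?_⟩
  · refine isMaskInverse_iff_summable.2 ⟨.of_nonneg_of_le (fun _ => abs_nonneg _) (fun _ => Complex.abs_re_le_norm _) hsummable,
      fun z => ?_⟩
    obtain ⟨x, rfl⟩ := exists_toCircle_eq z
    -- Summable coefficients make the Fourier series of `1 / α` converge to it at every point.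
    have h := has_pointwise_sum_fourier_series_of_summable (f := symbolInvMap α h0)
      hsummable.of_norm x
    rw [one_div, ← symbolMap_apply hsum, ← symbolInvMap_apply α h0, symbol, ← h.tsum_eq]
    congr 1 with k
    rw [hre, fourier_apply, AddCircle.toCircle_zsmul, Circle.coe_zpow, smul_eq_mul,
      fourierCoeffCLM_apply]
  · ext l
    rw [← Complex.ofReal_inj, hcoeff γ hγ, hre]
  · rw [← Real.norm_eq_abs, ← Complex.norm_real, hcoeff γ hγ]
    exact hbound l
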